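/- Let $N,L\ge 1$, let $\mathbf h_c,\mathbf h_s\in\mathbb C^{N}$ with $\mathbf h_s\neq 0$ be the communication and sensing channels, let $p_c,p_s,\alpha_s\ge 0$, and let $\mathbf s_s\in\mathbb C^{L}$ be a known deterministic sensing pulse with $L^{-1}\|\mathbf s_s\|^2=1$. Let $\mathbf s_c$ be a random vector in $\mathbb C^L$ with $\mathbb E\{\mathbf s_c\mathbf s_c^{\mathsf H}\}=\mathbf I_L$, let $\mathbf N_u\in\mathbb C^{N\times L}$ be independent of $\mathbf s_c$ with $\mathrm{vec}(\mathbf N_u)\sim\mathcal{CN}(\mathbf 0,\mathbf I)$, and put $\mathbf Z_c=\sqrt{p_c}\,\mathbf h_c\mathbf s_c^{\mathsf H}+\mathbf N_u$ (communication signal plus noise). In the uplink communications-centric (C-C) design $\mathbf Z_c$ is treated as Gaussian noise: it is replaced by a random matrix $\mathbf Z$ with $\mathrm{vec}(\mathbf Z)\sim\mathcal{CN}\big(\mathbf 0,\mathbb E\{\mathrm{vec}(\mathbf Z_c)\mathrm{vec}(\mathbf Z_c)^{\mathsf H}\}\big)$, independent of the target's reflection coefficient $\beta\sim\mathcal{CN}(0,\alpha_s)$.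 Here $\mathcal{CN}$ denotes the circularly symmetric complex Gaussian law. For a beamformer $\mathbf w\in\mathbb C^N$ with $\|\mathbf w\|=1$ let $$\mathbf Y=\sqrt{p_s}\,\beta\,\mathbf h_s\mathbf h_s^{\mathsf T}\mathbf w\,\mathbf s_s^{\mathsf H}+\mathbf Z ,\qquad \mathcal R(\mathbf w)=\frac1L\, I(\mathbf Y;\beta),$$ with mutual information $I$ measured in bits ($\mathbf w$ and $\mathbf s_s$ are known to the receiver). Then the sensing rate of the uplink C-C design, which uses $\mathbf w_s=\mathbf h_s^{*}/\|\mathbf h_s\|$, is finite and equals $$\mathcal R(\mathbf w_s)=\frac1L\log_2\!\left[1+p_sL\alpha_s\|\mathbf h_s\|^2\left(\|\mathbf h_s\|^2-\frac{p_c|\mathbf h_s^{\mathsf H}\mathbf h_c|^2}{1+p_c\|\mathbf h_c\|^2}\right)\right],$$ and this is the maximum of $\mathcal R(\mathbf w)$ over all $\mathbf w$ with $\|\mathbf w\|=1$. -/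

import Mathlib

open MeasureTheory ProbabilityTheory InformationTheory
open scoped ENNReal

noncomputable section

namespace UplinkISAC

/-- The matrix `E{X Xᴴ}` of a random vector `X` with complex entries. -/
def secondMoment {Ω ι : Type*} [MeasurableSpace Ω] (X : Ω → ι → ℂ) (P : Measure Ω) :
    Matrix ι ι ℂ :=
  Matrix.of fun i j => ∫ ω, X ω i * star (X ω j) ∂P

/-- `X ∼ 𝒞𝒩(0, R)`: the random vector `X` is circularly symmetric complex Gaussian, that is
(jointly, as a real random vector) Gaussian with mean zero, covariance `E{X Xᴴ} = R` and
pseudo-covariance `E{X Xᵀ} = 0`. -/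
structure IsCSCG {Ω ι : Type*} [MeasurableSpace Ω] [Fintype ι]
    (X : Ω → ι → ℂ) (R : Matrix ι ι ℂ) (P : Measure Ω) : Prop where
  hasGaussianLaw : HasGaussianLaw X P
  mean_eq : ∀ i, ∫ ω, X ω i ∂P = 0
  covariance_eq : secondMoment X P = R
  pseudoCovariance_eq : ∀ i j, ∫ ω, X ω i * X ω j ∂P = 0

/-- `b ∼ 𝒞𝒩(0, α)` for a complex random variable `b`. -/
def IsScalarCSCG {Ω : Type*} [MeasurableSpace Ω] (b : Ω → ℂ) (α : ℝ) (P : Measure Ω) : Prop :=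
  IsCSCG (fun ω (_ : Fin 1) => b ω) (Matrix.of fun _ _ => (α : ℂ)) P

/-- Mutual information `I(X; Y)` in nats: the Kullback-Leibler divergence of the joint law from
the product of the marginal laws. -/
def mutualInfo {Ω E F : Type*} [MeasurableSpace Ω] [MeasurableSpace E] [MeasurableSpace F]
    (X : Ω → E) (Y : Ω → F) (P : Measure Ω) : ℝ≥0∞ :=
  klDiv (P.map fun ω => (X ω, Y ω)) ((P.map X).prod (P.map Y))

/-- Mutual information in bits. -/
def mutualInfoBits {Ω E F : Type*} [MeasurableSpace Ω] [MeasurableSpace E] [MeasurableSpace F]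
    (X : Ω → E) (Y : Ω → F) (P : Measure Ω) : ℝ≥0∞ :=
  mutualInfo X Y P / ENNReal.ofReal (Real.log 2)

variable {N L : ℕ}

/-- The target response matrix `G = β h_s h_sᵀ`. -/
def targetResponse (b : ℂ) (hs : EuclideanSpace ℂ (Fin N)) : Matrix (Fin N) (Fin N) ℂ :=
  b • Matrix.vecMulVec hs.ofLp hs.ofLp

/-- The echo `√p_s G w s_sᴴ`. -/
def echo (ps : ℝ) (hs w : EuclideanSpace ℂ (Fin N)) (ss : EuclideanSpace ℂ (Fin L)) (b : ℂ) :
    Matrix (Fin N) (Fin L) ℂ :=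
  (Real.sqrt ps : ℂ) •
    Matrix.vecMulVec ((targetResponse b hs).mulVec w.ofLp) (star ss.ofLp)

/-- The aggregate interference-plus-noise `Z_c = √p_c h_c s_cᴴ + N_u`. -/
def interferencePlusNoise (pc : ℝ) (hc : EuclideanSpace ℂ (Fin N)) (sc : Fin L → ℂ)
    (Nu : Matrix (Fin N) (Fin L) ℂ) : Matrix (Fin N) (Fin L) ℂ :=
  (Real.sqrt pc : ℂ) • Matrix.vecMulVec hc.ofLp (star sc) + Nu

/-- The sensing beamformer `w_s = h_s^* / ‖h_s‖`. -/
def sensingBeamformer (hs : EuclideanSpace ℂ (Fin N)) : EuclideanSpace ℂ (Fin N) :=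
  ((‖hs‖⁻¹ : ℝ) : ℂ) • WithLp.toLp 2 (star hs.ofLp)

/-- The sensing rate: the mutual information, in bits per time slot, between the reflection
coefficient `β` and the received signal `Y = √p_s G w s_sᴴ + Z`, where `Z` is the disturbance.
The transmitted waveform is deterministic and known to the receiver, so that conditioning on it
is the same as fixing `w` and `s_s`. -/
def sensingRate {Ω : Type*} [MeasurableSpace Ω] (ps : ℝ) (hs w : EuclideanSpace ℂ (Fin N))
    (ss : EuclideanSpace ℂ (Fin L)) (β : Ω → ℂ) (Z : Ω → Matrix (Fin N) (Fin L) ℂ)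
    (P : Measure Ω) : ℝ≥0∞ :=
  mutualInfoBits (fun ω => (echo ps hs w ss (β ω) + Z ω).vec) β P / (L : ℝ≥0∞)

end UplinkISAC

end

/-! Let `b ∼ 𝒞𝒩(0, α)` be independent of `Z ∼ 𝒞𝒩(0, R)`, let `a` be a fixed vector, and put
`q = aᴴ R⁻¹ a` and `c = aᴴ R⁻¹ / q`, so that `c a = 1`. The map `y ↦ (c y, y - (c y) a)` is
injective. It sends `b a + Z` to `(b + c Z, Z - (c Z) a)`, where `c Z` and `Z - (c Z) a` are
jointly circular Gaussian and uncorrelated, hence independent, so the second component carries no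
information on `b`. What remains is the scalar channel `b + c Z` with `c Z ∼ 𝒞𝒩(0, 1 / q)`, whence
`I(b a + Z; b) = log (1 + α q)`.

The vectorized echo is `b a` with `a` proportional to the Kronecker product of `s_s^*` and `h_s`,
and `Z_c` has covariance `I ⊗ (I + p_c h_c h_cᴴ)`, so `q` factors and the Sherman–Morrison formula
evaluates it. It depends on `w` only through `|h_sᵀ w|`, which by Cauchy–Schwarz is largest at
`h_s^* / ‖h_s‖`.
-/

namespace UplinkISAC

open scoped Matrix ComplexOrder Kronecker

section MutualInformation

variable {Ω E F G : Type*} [MeasurableSpace Ω] [MeasurableSpace E] [MeasurableSpace F]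
  [MeasurableSpace G] {P : Measure Ω}

lemma mutualInfo_comp_le [IsFiniteMeasure P] {X : Ω → E} {Y : Ω → F} (hX : AEMeasurable X P)
    (hY : AEMeasurable Y P) {f : E → G} (hf : Measurable f) :
    mutualInfo (fun ω => f (X ω)) Y P ≤ mutualInfo X Y P := by
  have h := klDiv_map_le (P.map fun ω => (X ω, Y ω)) ((P.map X).prod (P.map Y))
    (g := Prod.map f id) (by fun_prop)
  rwa [AEMeasurable.map_map_of_aemeasurable (by fun_prop) (hX.prodMk hY),
    ← Measure.map_prod_map _ _ hf measurable_id,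
    AEMeasurable.map_map_of_aemeasurable hf.aemeasurable hX, Measure.map_id] at h

lemma mutualInfo_comp_of_leftInverse [IsFiniteMeasure P] {X : Ω → E} {Y : Ω → F}
    (hX : AEMeasurable X P) (hY : AEMeasurable Y P) {f : E → G} {g : G → E} (hf : Measurable f)
    (hg : Measurable g) (hgf : Function.LeftInverse g f) :
    mutualInfo (fun ω => f (X ω)) Y P = mutualInfo X Y P := by
  refine (mutualInfo_comp_le hX hY hf).antisymm ?_
  have h := mutualInfo_comp_le (X := fun ω => f (X ω)) (hf.comp_aemeasurable hX) hY hg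
  simpa only [hgf (X _)] using h

lemma indepFun_prodMk_left [IsFiniteMeasure P] {X : Ω → E} {Y : Ω → F} {Z : Ω → G}
    (hX : AEMeasurable X P) (hY : AEMeasurable Y P) (hZ : AEMeasurable Z P)
    (h : IndepFun X (fun ω => (Y ω, Z ω)) P) (hYZ : IndepFun Y Z P) :
    IndepFun (fun ω => (X ω, Y ω)) Z P := by
  have hXY : IndepFun X Y P := h.comp measurable_id measurable_fst
  rw [indepFun_iff_map_prod_eq_prod_map_map hX (hY.prodMk hZ),
    (indepFun_iff_map_prod_eq_prod_map_map hY hZ).1 hYZ] at h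
  rw [indepFun_iff_map_prod_eq_prod_map_map (hX.prodMk hY) hZ,
    (indepFun_iff_map_prod_eq_prod_map_map hX hY).1 hXY,
    ← (measurePreserving_prodAssoc (P.map X) (P.map Y) (P.map Z)).symm.map_eq, ← h,
    AEMeasurable.map_map_of_aemeasurable (by fun_prop) (hX.prodMk (hY.prodMk hZ))]
  rfl

lemma mutualInfo_of_indepFun [IsFiniteMeasure P] {X : Ω → E} {Y : Ω → F}
    (hX : AEMeasurable X P) (hY : AEMeasurable Y P) (h : IndepFun X Y P) :
    mutualInfo X Y P = 0 := by
  rw [mutualInfo, (indepFun_iff_map_prod_eq_prod_map_map hX hY).1 h, klDiv_self]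

lemma measurePreserving_prod_right_comm (μ : Measure E) (ν : Measure F) (ρ : Measure G)
    [SFinite μ] [SFinite ν] [SFinite ρ] :
    MeasurePreserving (fun z : (E × F) × G => ((z.1.1, z.2), z.1.2))
      ((μ.prod ν).prod ρ) ((μ.prod ρ).prod ν) :=
  (measurePreserving_prodAssoc μ ρ ν).symm.comp
    (((MeasurePreserving.id μ).prod Measure.measurePreserving_swap).comp
      (measurePreserving_prodAssoc μ ν ρ))

lemma mutualInfo_prodMk_of_indepFun [IsProbabilityMeasure P] {T : Ω → E} {Y : Ω → F} {W : Ω → G}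
    (hT : AEMeasurable T P) (hY : AEMeasurable Y P) (hW : AEMeasurable W P)
    (h : IndepFun (fun ω => (T ω, Y ω)) W P) :
    mutualInfo (fun ω => (T ω, W ω)) Y P = mutualInfo T Y P := by
  have := Measure.isProbabilityMeasure_map hW
  have hTW : IndepFun T W P := h.comp measurable_fst measurable_id
  refine le_antisymm ?_ (mutualInfo_comp_le (hT.prodMk hW) hY measurable_fst)
  let k : (E × F) × G → (E × G) × F := fun z => ((z.1.1, z.2), z.1.2)
  have hk : Measurable k := by fun_prop
  have hjoint : ((P.map fun ω => (T ω, Y ω)).prod (P.map W)).map k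
      = P.map fun ω => ((T ω, W ω), Y ω) := by
    rw [← (indepFun_iff_map_prod_eq_prod_map_map (hT.prodMk hY) hW).1 h,
      AEMeasurable.map_map_of_aemeasurable hk.aemeasurable ((hT.prodMk hY).prodMk hW)]
    rfl
  have hprod : (((P.map T).prod (P.map Y)).prod (P.map W)).map k
      = (P.map fun ω => (T ω, W ω)).prod (P.map Y) := by
    rw [(indepFun_iff_map_prod_eq_prod_map_map hT hW).1 hTW]
    exact (measurePreserving_prod_right_comm _ _ _).map_eq
  calc mutualInfo (fun ω => (T ω, W ω)) Y P
      ≤ klDiv ((P.map fun ω => (T ω, Y ω)).prod (P.map W))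
          (((P.map T).prod (P.map Y)).prod (P.map W)) := by
        rw [mutualInfo, ← hjoint, ← hprod]
        exact klDiv_map_le _ _ hk
    _ = mutualInfo T Y P := by
        rw [← Measure.compProd_const, ← Measure.compProd_const, klDiv_compProd_left, mutualInfo]

end MutualInformation

section AdditiveNoise

variable {Ω G : Type*} [MeasurableSpace Ω] {P : Measure Ω}
  [AddCommGroup G] [MeasurableSpace G] [MeasurableAdd₂ G] [MeasurableSub₂ G]
  {m : Measure G} [m.IsAddLeftInvariant]

lemma map_add_prodMk_eq_withDensity [IsFiniteMeasure P] {X V : Ω → G} (hX : AEMeasurable X P)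
    (hV : AEMeasurable V P) (hXV : IndepFun X V P) {p r : G → ℝ≥0∞} (hp : Measurable p)
    (hr : Measurable r) (hr0 : ∀ t, r t ≠ 0) (hrtop : ∀ t, r t ≠ ∞)
    (hVp : P.map V = m.withDensity p) (hTr : P.map (fun ω => X ω + V ω) = m.withDensity r) :
    P.map (fun ω => (X ω + V ω, X ω)) =
      ((P.map fun ω => X ω + V ω).prod (P.map X)).withDensity
        fun z => p (z.1 - z.2) / r z.1 := by
  let k : G × G → G × G := fun z => (z.1 + z.2, z.1)
  have hk : Measurable k := by fun_prop
  have hjoint : P.map (fun ω => (X ω + V ω, X ω)) = ((P.map X).prod (P.map V)).map k := by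
    rw [← (indepFun_iff_map_prod_eq_prod_map_map hX hV).1 hXV,
      AEMeasurable.map_map_of_aemeasurable hk.aemeasurable (hX.prodMk hV)]
    rfl
  have hd : Measurable fun z : G × G => p (z.1 - z.2) / r z.1 := by fun_prop
  refine Measure.ext_of_lintegral _ fun φ hφ => ?_
  rw [hjoint, lintegral_map hφ hk, lintegral_prod _ (by fun_prop),
    lintegral_withDensity_eq_lintegral_mul _ hd hφ, lintegral_prod_symm _ (by fun_prop)]
  refine lintegral_congr fun x => ?_
  rw [hVp, hTr, lintegral_withDensity_eq_lintegral_mul _ hp (by fun_prop),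
    lintegral_withDensity_eq_lintegral_mul _ hr (by fun_prop),
    ← lintegral_add_left_eq_self (μ := m)
      (r * ((fun z : G × G => p (z.1 - z.2) / r z.1) * φ <| ⟨·, x⟩)) x]
  refine lintegral_congr fun v => ?_
  simp only [Pi.mul_apply, k, add_sub_cancel_left]
  rw [← mul_assoc, ENNReal.mul_div_cancel (hr0 _) (hrtop _)]

lemma mutualInfo_add_eq_integral_log [IsProbabilityMeasure P] {X V : Ω → G}
    (hX : AEMeasurable X P) (hV : AEMeasurable V P) (hXV : IndepFun X V P) {p r : G → ℝ}
    (hp : Measurable p) (hr : Measurable r) (hp0 : ∀ t, 0 ≤ p t) (hr0 : ∀ t, 0 < r t)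
    (hVp : P.map V = m.withDensity fun t => ENNReal.ofReal (p t))
    (hTr : P.map (fun ω => X ω + V ω) = m.withDensity fun t => ENNReal.ofReal (r t))
    (hint : Integrable (fun ω => Real.log (p (V ω) / r (X ω + V ω))) P) :
    mutualInfo (fun ω => X ω + V ω) X P =
      ENNReal.ofReal (∫ ω, Real.log (p (V ω) / r (X ω + V ω)) ∂P) := by
  have hTX : AEMeasurable (fun ω => (X ω + V ω, X ω)) P := (hX.add hV).prodMk hX
  have hdens := map_add_prodMk_eq_withDensity hX hV hXV hp.ennreal_ofReal hr.ennreal_ofReal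
    (fun t => (ENNReal.ofReal_pos.2 (hr0 t)).ne') (fun _ => ENNReal.ofReal_ne_top) hVp hTr
  have := Measure.isProbabilityMeasure_map hX
  have := Measure.isProbabilityMeasure_map (hX.add hV)
  have := Measure.isProbabilityMeasure_map hTX
  set μ := P.map fun ω => (X ω + V ω, X ω)
  set ν := (P.map fun ω => X ω + V ω).prod (P.map X)
  have hac : μ ≪ ν := hdens ▸ withDensity_absolutelyContinuous _ _
  let g : G × G → ℝ := fun z => Real.log (p (z.1 - z.2) / r z.1)
  have hg : AEStronglyMeasurable g μ := by fun_prop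
  have hgT : ∀ ω, g (X ω + V ω, X ω) = Real.log (p (V ω) / r (X ω + V ω)) := fun ω => by
    simp only [g, add_sub_cancel_left]
  have hllr : llr μ ν =ᵐ[μ] g := by
    have h := Measure.rnDeriv_withDensity ν (f := fun z : G × G =>
      ENNReal.ofReal (p (z.1 - z.2)) / ENNReal.ofReal (r z.1)) (by fun_prop)
    rw [← hdens] at h
    filter_upwards [hac.ae_le h] with z hz
    rw [llr, hz, ← ENNReal.ofReal_div_of_pos (hr0 _),
      ENNReal.toReal_ofReal (div_nonneg (hp0 _) (hr0 _).le)]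
  have hgint : Integrable g μ := by
    rw [integrable_map_measure hg hTX]
    exact hint.congr (.of_forall fun ω => (hgT ω).symm)
  rw [mutualInfo, klDiv_of_ac_of_integrable hac ((integrable_congr hllr).2 hgint),
    integral_congr_ae hllr, integral_map hTX hg]
  simp only [hgT, probReal_univ, add_sub_cancel_right]

end AdditiveNoise

section Moments

variable {Ω ι κ : Type*} [MeasurableSpace Ω] {P : Measure Ω}

/-- The matrix `E{X Yᵀ}` of two complex random vectors. Both kinds of second moments are instances:
`E{X Xᴴ}` is `crossMoment X (star X) P` and the pseudo-covariance `E{X Xᵀ}` is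
`crossMoment X X P`. -/
noncomputable def crossMoment (X : Ω → ι → ℂ) (Y : Ω → κ → ℂ) (P : Measure Ω) : Matrix ι κ ℂ :=
  Matrix.of fun i j => ∫ ω, X ω i * Y ω j ∂P

lemma integral_dotProduct [Fintype ι] {X : Ω → ι → ℂ} (hX : Integrable X P) (u : ι → ℂ) :
    ∫ ω, u ⬝ᵥ X ω ∂P = u ⬝ᵥ fun i => ∫ ω, X ω i ∂P := by
  simp only [dotProduct]
  rw [integral_finsetSum _ fun i _ => (hX.eval i).const_mul (u i)]
  simp only [integral_const_mul]

lemma integral_dotProduct_mul_dotProduct [Fintype ι] [Fintype κ] {X : Ω → ι → ℂ} {Y : Ω → κ → ℂ}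
    (hX : MemLp X 2 P) (hY : MemLp Y 2 P) (u : ι → ℂ) (v : κ → ℂ) :
    ∫ ω, (u ⬝ᵥ X ω) * (v ⬝ᵥ Y ω) ∂P = u ⬝ᵥ crossMoment X Y P *ᵥ v := by
  have hint : ∀ i j, Integrable (fun ω => u i * (X ω i * Y ω j) * v j) P := fun i j =>
    (((hX.eval i).integrable_mul (hY.eval j)).const_mul (u i)).mul_const (v j)
  have hexp : ∀ ω, (u ⬝ᵥ X ω) * (v ⬝ᵥ Y ω) = ∑ i, ∑ j, u i * (X ω i * Y ω j) * v j := fun ω => by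
    simp only [dotProduct, Finset.sum_mul_sum]
    exact Finset.sum_congr rfl fun i _ => Finset.sum_congr rfl fun j _ => by ring
  simp_rw [hexp]
  rw [integral_finsetSum _ fun i _ => integrable_finsetSum _ fun j _ => hint i j]
  refine Finset.sum_congr rfl fun i _ => ?_
  rw [integral_finsetSum _ fun j _ => hint i j]
  simp only [integral_mul_const, integral_const_mul]
  simp only [Matrix.mulVec, dotProduct, Finset.mul_sum, crossMoment, Matrix.of_apply, mul_assoc]

lemma crossMoment_eq_zero_of_indepFun {X : Ω → ι → ℂ} {Y : Ω → κ → ℂ}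
    (hX : AEStronglyMeasurable X P) (hY : AEStronglyMeasurable Y P)
    (hXY : IndepFun X Y P) (hX0 : ∀ i, ∫ ω, X ω i ∂P = 0) : crossMoment X Y P = 0 := by
  ext i j
  have h : IndepFun (fun ω => X ω i) (fun ω => Y ω j) P :=
    hXY.comp (measurable_pi_apply i) (measurable_pi_apply j)
  rw [crossMoment, Matrix.of_apply, h.integral_fun_mul_eq_mul_integral
    ((continuous_apply i).comp_aestronglyMeasurable hX)
    ((continuous_apply j).comp_aestronglyMeasurable hY), hX0, zero_mul, Matrix.zero_apply]

lemma transpose_crossMoment (X : Ω → ι → ℂ) (Y : Ω → κ → ℂ) :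
    (crossMoment X Y P)ᵀ = crossMoment Y X P := by
  ext i j
  simp only [crossMoment, Matrix.transpose_apply, Matrix.of_apply, mul_comm]

lemma crossMoment_add_left [Fintype ι] [Fintype κ] {X X' : Ω → ι → ℂ} {Y : Ω → κ → ℂ}
    (hX : MemLp X 2 P) (hX' : MemLp X' 2 P) (hY : MemLp Y 2 P) :
    crossMoment (X + X') Y P = crossMoment X Y P + crossMoment X' Y P := by
  ext i j
  simp only [crossMoment, Matrix.add_apply, Matrix.of_apply, Pi.add_apply, add_mul]
  exact integral_add ((hX.eval i).integrable_mul (hY.eval j))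
    ((hX'.eval i).integrable_mul (hY.eval j))

lemma crossMoment_add_right [Fintype ι] [Fintype κ] {X : Ω → ι → ℂ} {Y Y' : Ω → κ → ℂ}
    (hX : MemLp X 2 P) (hY : MemLp Y 2 P) (hY' : MemLp Y' 2 P) :
    crossMoment X (Y + Y') P = crossMoment X Y P + crossMoment X Y' P := by
  rw [← transpose_crossMoment, crossMoment_add_left hY hY' hX, Matrix.transpose_add,
    transpose_crossMoment, transpose_crossMoment]

lemma crossMoment_add_add [Fintype ι] [Fintype κ] {X X' : Ω → ι → ℂ} {Y Y' : Ω → κ → ℂ}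
    (hX : MemLp X 2 P) (hX' : MemLp X' 2 P) (hY : MemLp Y 2 P) (hY' : MemLp Y' 2 P)
    (hXY' : IndepFun X Y' P) (hX'Y : IndepFun X' Y P) (hX'0 : ∀ i, ∫ ω, X' ω i ∂P = 0)
    (hY'0 : ∀ j, ∫ ω, Y' ω j ∂P = 0) :
    crossMoment (X + X') (Y + Y') P = crossMoment X Y P + crossMoment X' Y' P := by
  have hzero : crossMoment X' Y P = 0 := crossMoment_eq_zero_of_indepFun hX'.1 hY.1 hX'Y hX'0
  have hzero' : crossMoment X Y' P = 0 := by
    rw [← transpose_crossMoment, crossMoment_eq_zero_of_indepFun hY'.1 hX.1 hXY'.symm hY'0,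
      Matrix.transpose_zero]
  rw [crossMoment_add_left hX hX' (hY.add hY'), crossMoment_add_right hX hY hY',
    crossMoment_add_right hX' hY hY', hzero, hzero', add_zero, zero_add]

lemma secondMoment_eq_crossMoment (X : Ω → ι → ℂ) :
    secondMoment X P = crossMoment X (star X) P :=
  rfl

lemma secondMoment_add_of_indepFun [Fintype ι] {X Y : Ω → ι → ℂ} (hX : MemLp X 2 P)
    (hY : MemLp Y 2 P) (hXY : IndepFun X Y P) (hY0 : ∀ i, ∫ ω, Y ω i ∂P = 0) :
    secondMoment (X + Y) P = secondMoment X P + secondMoment Y P := by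
  have hstar : Measurable (star : (ι → ℂ) → ι → ℂ) := continuous_star.measurable
  simp only [secondMoment_eq_crossMoment, star_add]
  refine crossMoment_add_add hX hY hX.star hY.star (hXY.comp measurable_id hstar)
    (hXY.symm.comp measurable_id hstar) hY0 fun i => ?_
  simp only [Pi.star_apply, Complex.star_def]
  rw [integral_conj, hY0, map_zero]

lemma memLp_two_of_secondMoment_apply_ne_zero [Fintype ι] {X : Ω → ι → ℂ}
    (hX : AEStronglyMeasurable X P) (h : ∀ i, secondMoment X P i i ≠ 0) : MemLp X 2 P := by
  refine MemLp.of_eval fun i => (memLp_two_iff_integrable_sq_norm (by fun_prop)).2 ?_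
  have hint : Integrable (fun ω => X ω i * star (X ω i)) P := not_imp_comm.1 integral_undef (h i)
  refine hint.norm.congr (.of_forall fun ω => ?_)
  simp only [norm_mul, norm_star, sq]

lemma secondMoment_vec_vecMulVec_star (u : ι → ℂ) (s : Ω → κ → ℂ) :
    secondMoment (fun ω => (Matrix.vecMulVec u (star (s ω))).vec) P =
      (secondMoment s P)ᵀ ⊗ₖ Matrix.vecMulVec u (star u) := by
  ext ⟨j, i⟩ ⟨j', i'⟩
  simp only [secondMoment, Matrix.of_apply, Matrix.vec, Matrix.vecMulVec_apply, Pi.star_apply,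
    star_mul', star_star, Matrix.kroneckerMap_apply, Matrix.transpose_apply,
    ← integral_mul_const]
  exact integral_congr_ae (.of_forall fun ω => by simp only; ring)

end Moments

section ComplexGaussianVector

variable {Ω ι κ κ' : Type*} [MeasurableSpace Ω] [Fintype ι] {P : Measure Ω}

namespace IsCSCG

variable {X : Ω → ι → ℂ} {R : Matrix ι ι ℂ}

lemma memLp_two (hX : IsCSCG X R P) : MemLp X 2 P :=
  hX.hasGaussianLaw.memLp_two

lemma crossMoment_self (hX : IsCSCG X R P) : crossMoment X X P = 0 := by
  ext i j
  exact hX.pseudoCovariance_eq i j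

lemma integral_dotProduct_eq_zero (hX : IsCSCG X R P) (u : ι → ℂ) : ∫ ω, u ⬝ᵥ X ω ∂P = 0 := by
  rw [integral_dotProduct hX.hasGaussianLaw.integrable]
  simp only [hX.mean_eq, dotProduct, mul_zero, Finset.sum_const_zero]

lemma integral_dotProduct_mul (hX : IsCSCG X R P) (u v : ι → ℂ) :
    ∫ ω, (u ⬝ᵥ X ω) * (v ⬝ᵥ X ω) ∂P = 0 := by
  rw [integral_dotProduct_mul_dotProduct hX.memLp_two hX.memLp_two, hX.crossMoment_self,
    Matrix.zero_mulVec, dotProduct_zero]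

lemma integral_dotProduct_mul_star (hX : IsCSCG X R P) (u v : ι → ℂ) :
    ∫ ω, (u ⬝ᵥ X ω) * star (v ⬝ᵥ X ω) ∂P = u ⬝ᵥ R *ᵥ star v := by
  have h := integral_dotProduct_mul_dotProduct hX.memLp_two hX.memLp_two.star u (star v)
  rw [← secondMoment_eq_crossMoment, hX.covariance_eq] at h
  rw [← h]
  exact integral_congr_ae (.of_forall fun ω => by
    simp only [Pi.star_apply, Matrix.star_dotProduct_star, dotProduct_comm v])

end IsCSCG

lemma integral_re_mul_re {f g : Ω → ℂ} (hf : MemLp f 2 P) (hg : MemLp g 2 P) :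
    ∫ ω, (f ω).re * (g ω).re ∂P = (∫ ω, f ω * g ω ∂P + ∫ ω, f ω * star (g ω) ∂P).re / 2 := by
  have hfg : Integrable (fun ω => f ω * g ω) P := hf.integrable_mul hg
  have hfg' : Integrable (fun ω => f ω * star (g ω)) P := hf.integrable_mul hg.star
  rw [← integral_add hfg hfg', ← RCLike.re_to_complex, ← integral_re (hfg.fun_add hfg'),
    ← integral_div]
  refine integral_congr_ae (.of_forall fun ω => ?_)
  simp only [RCLike.re_to_complex, Complex.add_re, Complex.mul_re, Complex.star_def,
    Complex.conj_re, Complex.conj_im]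
  ring

lemma exists_eq_re_dotProduct (l : StrongDual ℝ (ι → ℂ)) :
    ∃ u : ι → ℂ, ∀ z, l z = (u ⬝ᵥ z).re := by
  classical
  refine ⟨fun i => l (Pi.single i 1) - l (Pi.single i Complex.I) * Complex.I, fun z => ?_⟩
  have hz : z = ∑ i, ((z i).re • (Pi.single i 1 : ι → ℂ) +
      (z i).im • (Pi.single i Complex.I : ι → ℂ)) := by
    ext j
    simp [Finset.sum_apply, Pi.single_apply, Finset.sum_add_distrib, Complex.re_add_im]
  conv_lhs => rw [hz]
  simp only [map_sum, map_add, map_smul, smul_eq_mul, dotProduct, Complex.re_sum]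
  refine Finset.sum_congr rfl fun i _ => ?_
  simp only [Complex.mul_re, Complex.mul_im, Complex.sub_re, Complex.sub_im, Complex.ofReal_re,
    Complex.ofReal_im, Complex.I_re, Complex.I_im]
  ring

namespace IsCSCG

variable {X : Ω → ι → ℂ} {R : Matrix ι ι ℂ}

lemma hasGaussianLaw_mulVec [Finite κ] (hX : IsCSCG X R P) (A : Matrix κ ι ℂ) :
    HasGaussianLaw (fun ω => A *ᵥ X ω) P := by
  cases nonempty_fintype κ
  exact hX.hasGaussianLaw.map_fun (LinearMap.toContinuousLinearMap (A.mulVecLin.restrictScalars ℝ))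

lemma mulVec [Fintype κ] (hX : IsCSCG X R P) (A : Matrix κ ι ℂ) :
    IsCSCG (fun ω => A *ᵥ X ω) (A * R * Aᴴ) P where
  hasGaussianLaw := hX.hasGaussianLaw_mulVec A
  mean_eq i := hX.integral_dotProduct_eq_zero (A i)
  covariance_eq := by
    ext i j
    refine (hX.integral_dotProduct_mul_star (A i) (A j)).trans ?_
    rw [Matrix.mul_assoc]
    rfl
  pseudoCovariance_eq i j := hX.integral_dotProduct_mul (A i) (A j)

lemma hasGaussianLaw_dotProduct (hX : IsCSCG X R P) (u : ι → ℂ) :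
    HasGaussianLaw (fun ω => u ⬝ᵥ X ω) P :=
  HasGaussianLaw.eval (X := fun i ω => (Matrix.replicateRow (Fin 1) u *ᵥ X ω) i)
    (hX.hasGaussianLaw_mulVec _) 0

lemma covariance_re_dotProduct (hX : IsCSCG X R P) (u v : ι → ℂ) :
    cov[fun ω => (u ⬝ᵥ X ω).re, fun ω => (v ⬝ᵥ X ω).re; P] = (u ⬝ᵥ R *ᵥ star v).re / 2 := by
  have := hX.hasGaussianLaw.isProbabilityMeasure
  have hu := hX.hasGaussianLaw_dotProduct u
  have hv := hX.hasGaussianLaw_dotProduct v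
  have hure : MemLp (fun ω => (u ⬝ᵥ X ω).re) 2 P := hu.memLp_two.re
  have hvre : MemLp (fun ω => (v ⬝ᵥ X ω).re) 2 P := hv.memLp_two.re
  have hu0 : ∫ ω, (u ⬝ᵥ X ω).re ∂P = 0 :=
    (integral_re hu.integrable).trans (by rw [hX.integral_dotProduct_eq_zero, map_zero])
  rw [covariance_eq_sub hure hvre, hu0, zero_mul, sub_zero]
  simp only [Pi.mul_apply]
  rw [integral_re_mul_re hu.memLp_two hv.memLp_two, hX.integral_dotProduct_mul,
    hX.integral_dotProduct_mul_star, zero_add]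

lemma indepFun_mulVec [Finite κ] [Finite κ'] (hX : IsCSCG X R P) {A : Matrix κ ι ℂ}
    {B : Matrix κ' ι ℂ} (hAB : A * R * Bᴴ = 0) :
    IndepFun (fun ω => A *ᵥ X ω) (fun ω => B *ᵥ X ω) P := by
  cases nonempty_fintype κ
  cases nonempty_fintype κ'
  have hjoint : HasGaussianLaw (fun ω => (A *ᵥ X ω, B *ᵥ X ω)) P :=
    hX.hasGaussianLaw.map_fun (LinearMap.toContinuousLinearMap
      ((A.mulVecLin.prod B.mulVecLin).restrictScalars ℝ))
  refine hjoint.indepFun_of_covariance_strongDual fun l₁ l₂ => ?_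
  obtain ⟨u, hu⟩ := exists_eq_re_dotProduct l₁
  obtain ⟨v, hv⟩ := exists_eq_re_dotProduct l₂
  have hcov := hX.covariance_re_dotProduct (u ᵥ* A) (v ᵥ* B)
  have hzero : (u ᵥ* A) ⬝ᵥ R *ᵥ star (v ᵥ* B) = 0 := by
    rw [Matrix.star_vecMul, Matrix.mulVec_mulVec, ← Matrix.dotProduct_mulVec,
      Matrix.mulVec_mulVec, ← Matrix.mul_assoc, hAB, Matrix.zero_mulVec, dotProduct_zero]
  rw [hzero, Complex.zero_re, zero_div] at hcov
  simpa only [Function.comp_def, hu, hv, Matrix.dotProduct_mulVec] using hcov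

lemma dotProduct (hX : IsCSCG X R P) {u : ι → ℂ} {α : ℝ} (hα : u ⬝ᵥ R *ᵥ star u = α) :
    IsScalarCSCG (fun ω => u ⬝ᵥ X ω) α P := by
  have hcov : Matrix.replicateRow (Fin 1) u * R * (Matrix.replicateRow (Fin 1) u)ᴴ =
      Matrix.of fun _ _ => (α : ℂ) := by
    ext i j
    rw [Matrix.mul_assoc]
    exact hα
  rw [IsScalarCSCG, ← hcov]
  exact hX.mulVec (Matrix.replicateRow (Fin 1) u)

lemma add {Y : Ω → ι → ℂ} {S : Matrix ι ι ℂ} (hX : IsCSCG X R P) (hY : IsCSCG Y S P)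
    (hXY : IndepFun X Y P) : IsCSCG (fun ω => X ω + Y ω) (R + S) P where
  hasGaussianLaw := (hXY.hasGaussianLaw hX.hasGaussianLaw hY.hasGaussianLaw).fun_add
  mean_eq i := by
    simp only [Pi.add_apply]
    rw [integral_add (hX.hasGaussianLaw.integrable.eval i) (hY.hasGaussianLaw.integrable.eval i),
      hX.mean_eq, hY.mean_eq, add_zero]
  covariance_eq := by
    rw [← hX.covariance_eq, ← hY.covariance_eq]
    exact secondMoment_add_of_indepFun hX.memLp_two hY.memLp_two hXY hY.mean_eq
  pseudoCovariance_eq i j := by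
    have h := crossMoment_add_add hX.memLp_two hY.memLp_two hX.memLp_two hY.memLp_two hXY hXY.symm
      hY.mean_eq hY.mean_eq
    rw [hX.crossMoment_self, hY.crossMoment_self, add_zero] at h
    exact congrFun₂ h i j

end IsCSCG

end ComplexGaussianVector

section ComplexGaussian

variable {Ω : Type*} [MeasurableSpace Ω] {P : Measure Ω}

/-- The density of the scalar law `𝒞𝒩(0, v)` with respect to Lebesgue measure on `ℂ`. At `v = 0`,
where the law is a Dirac mass, it takes the junk value `0`. -/
noncomputable def complexGaussianPDFReal (v : ℝ) (z : ℂ) : ℝ :=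
  (Real.pi * v)⁻¹ * Real.exp (-‖z‖ ^ 2 / v)

lemma complexGaussianPDFReal_pos {v : ℝ} (hv : 0 < v) (z : ℂ) :
    0 < complexGaussianPDFReal v z := by
  have := Real.pi_pos
  unfold complexGaussianPDFReal
  positivity

@[fun_prop]
lemma measurable_complexGaussianPDFReal (v : ℝ) : Measurable (complexGaussianPDFReal v) := by
  unfold complexGaussianPDFReal
  fun_prop

lemma complexGaussianPDFReal_eq_mul {v : ℝ} (hv : 0 ≤ v) (z : ℂ) :
    complexGaussianPDFReal v z =
      gaussianPDFReal 0 (v / 2).toNNReal z.re * gaussianPDFReal 0 (v / 2).toNNReal z.im := by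
  simp only [gaussianPDFReal, complexGaussianPDFReal, sub_zero,
    Real.coe_toNNReal _ (div_nonneg hv zero_le_two), ← Complex.normSq_eq_norm_sq,
    Complex.normSq_apply]
  rw [mul_mul_mul_comm, ← Real.exp_add, ← mul_inv, Real.mul_self_sqrt (by positivity)]
  ring_nf

lemma log_complexGaussianPDFReal_div {v s : ℝ} (hv : 0 < v) (hs : 0 < s) (z t : ℂ) :
    Real.log (complexGaussianPDFReal v z / complexGaussianPDFReal s t) =
      Real.log (s / v) - ‖z‖ ^ 2 / v + ‖t‖ ^ 2 / s := by
  have hratio : complexGaussianPDFReal v z / complexGaussianPDFReal s t =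
      s / v * Real.exp (-‖z‖ ^ 2 / v - -‖t‖ ^ 2 / s) := by
    rw [complexGaussianPDFReal, complexGaussianPDFReal, Real.exp_sub]
    have := Real.pi_pos
    field_simp
  rw [hratio, Real.log_mul (div_pos hs hv).ne' (Real.exp_ne_zero _), Real.log_exp]
  ring

namespace IsScalarCSCG

variable {b V : Ω → ℂ} {α v : ℝ}

lemma gaussianLaw (hb : IsScalarCSCG b α P) : HasGaussianLaw b P :=
  HasGaussianLaw.eval (X := fun _ : Fin 1 => b) hb.hasGaussianLaw 0

lemma integral_norm_sq (hb : IsScalarCSCG b α P) : ∫ ω, ‖b ω‖ ^ 2 ∂P = α := by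
  have h : ∫ ω, b ω * star (b ω) ∂P = α := congrFun₂ hb.covariance_eq 0 0
  simp only [Complex.star_def, Complex.mul_conj, Complex.normSq_eq_norm_sq,
    integral_complex_ofReal] at h
  exact_mod_cast h

lemma integrable_norm_sq (hb : IsScalarCSCG b α P) : Integrable (fun ω => ‖b ω‖ ^ 2) P :=
  hb.gaussianLaw.memLp_two.integrable_norm_pow two_ne_zero

lemma nonneg (hb : IsScalarCSCG b α P) : 0 ≤ α :=
  hb.integral_norm_sq ▸ integral_nonneg fun _ => sq_nonneg _

lemma add (hb : IsScalarCSCG b α P) (hV : IsScalarCSCG V v P) (hbV : IndepFun b V P) :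
    IsScalarCSCG (fun ω => b ω + V ω) (α + v) P := by
  have hconst : Measurable fun (z : ℂ) (_ : Fin 1) => z := by fun_prop
  have h := IsCSCG.add hb hV (hbV.comp hconst hconst)
  have hcov : (Matrix.of fun _ _ : Fin 1 => (α : ℂ)) + (Matrix.of fun _ _ => (v : ℂ)) =
      Matrix.of fun _ _ => ((α + v : ℝ) : ℂ) := by
    ext _ _
    exact (Complex.ofReal_add α v).symm
  rw [hcov] at h
  exact h

lemma covariance_re_mul (hb : IsScalarCSCG b α P) (u v : ℂ) :
    cov[fun ω => (u * b ω).re, fun ω => (v * b ω).re; P] = α * (u * star v).re / 2 := by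
  have h := hb.covariance_re_dotProduct (fun _ => u) (fun _ => v)
  simp only [dotProduct, Matrix.mulVec, Finset.univ_unique, Finset.sum_singleton,
    Matrix.of_apply, Pi.star_apply] at h
  rw [h, mul_left_comm, Complex.re_ofReal_mul]

lemma map_re_mul (hb : IsScalarCSCG b α P) {u : ℂ} (hu : ‖u‖ = 1) :
    P.map (fun ω => (u * b ω).re) = gaussianReal 0 (α / 2).toNNReal := by
  have hre : HasGaussianLaw (fun ω => (u * b ω).re) P :=
    hb.gaussianLaw.map_fun (Complex.reCLM.comp (ContinuousLinearMap.mul ℝ ℂ u))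
  have hmean : ∫ ω, (u * b ω).re ∂P = 0 := by
    have h := integral_re (hb.gaussianLaw.integrable.const_mul u)
    rw [integral_const_mul, show ∫ ω, b ω ∂P = 0 from hb.mean_eq 0, mul_zero, map_zero] at h
    exact h
  have hvar : Var[fun ω => (u * b ω).re; P] = α / 2 := by
    rw [← covariance_self hre.aemeasurable, hb.covariance_re_mul, Complex.star_def,
      Complex.mul_conj, Complex.normSq_eq_norm_sq, hu]
    norm_num
  rw [hre.map_eq_gaussianReal, hmean, hvar]

lemma map_re_im (hb : IsScalarCSCG b α P) :
    P.map (fun ω => ((b ω).re, (b ω).im)) =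
      (gaussianReal 0 (α / 2).toNNReal).prod (gaussianReal 0 (α / 2).toNNReal) := by
  have := hb.gaussianLaw.isProbabilityMeasure
  have hjoint : HasGaussianLaw (fun ω => ((b ω).re, (b ω).im)) P :=
    hb.gaussianLaw.map_equiv Complex.equivRealProdCLM
  have hre : P.map (fun ω => (b ω).re) = gaussianReal 0 (α / 2).toNNReal := by
    simpa only [one_mul] using hb.map_re_mul norm_one
  have him : P.map (fun ω => (b ω).im) = gaussianReal 0 (α / 2).toNNReal := by
    simpa [Complex.mul_re] using hb.map_re_mul (u := -Complex.I) (by simp)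
  have hind : IndepFun (fun ω => (b ω).re) (fun ω => (b ω).im) P := by
    refine hjoint.indepFun_of_covariance_eq_zero ?_
    simpa [Complex.mul_re] using hb.covariance_re_mul 1 (-Complex.I)
  rw [(indepFun_iff_map_prod_eq_prod_map_map hjoint.fst.aemeasurable
    hjoint.snd.aemeasurable).1 hind, hre, him]

lemma map_eq_withDensity (hb : IsScalarCSCG b α P) (hα : 0 < α) :
    P.map b = volume.withDensity fun z => ENNReal.ofReal (complexGaussianPDFReal α z) := by
  have hv : (α / 2).toNNReal ≠ 0 := (Real.toNNReal_pos.2 (half_pos hα)).ne'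
  have hmap : P.map b = (P.map fun ω => ((b ω).re, (b ω).im)).map
      Complex.measurableEquivRealProd.symm := by
    have hb' := hb.gaussianLaw.aemeasurable
    rw [AEMeasurable.map_map_of_aemeasurable (by fun_prop) (by fun_prop)]
    rfl
  rw [hmap, hb.map_re_im, gaussianReal_of_var_ne_zero _ hv,
    prod_withDensity (by fun_prop) (by fun_prop)]
  refine Measure.ext_of_lintegral _ fun φ hφ => ?_
  rw [lintegral_map hφ (by fun_prop),
    lintegral_withDensity_eq_lintegral_mul _ (by fun_prop) (by fun_prop),
    lintegral_withDensity_eq_lintegral_mul _ (by fun_prop) hφ,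
    Complex.volume_preserving_equiv_real_prod.symm.lintegral_map_equiv, ← Measure.volume_eq_prod]
  refine lintegral_congr fun z => ?_
  simp only [Pi.mul_apply, complexGaussianPDFReal_eq_mul hα.le,
    ENNReal.ofReal_mul (gaussianPDFReal_nonneg _ _ _)]
  rfl

lemma mutualInfo_add (hb : IsScalarCSCG b α P) (hV : IsScalarCSCG V v P)
    (hbV : IndepFun b V P) (hv : 0 < v) :
    mutualInfo (fun ω => b ω + V ω) b P = ENNReal.ofReal (Real.log (1 + α / v)) := by
  have := hb.gaussianLaw.isProbabilityMeasure
  have hT := hb.add hV hbV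
  have hs : 0 < α + v := add_pos_of_nonneg_of_pos hb.nonneg hv
  have hV2 := hV.integrable_norm_sq.div_const v
  have hT2 := hT.integrable_norm_sq.div_const (α + v)
  have hdiff : Integrable (fun ω => Real.log ((α + v) / v) - ‖V ω‖ ^ 2 / v) P :=
    (integrable_const _).sub hV2
  rw [mutualInfo_add_eq_integral_log hb.gaussianLaw.aemeasurable hV.gaussianLaw.aemeasurable hbV
    (measurable_complexGaussianPDFReal v) (measurable_complexGaussianPDFReal (α + v))
    (fun t => (complexGaussianPDFReal_pos hv t).le) (complexGaussianPDFReal_pos hs)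
    (hV.map_eq_withDensity hv) (hT.map_eq_withDensity hs)]
  all_goals simp only [log_complexGaussianPDFReal_div hv hs]
  · rw [integral_add hdiff hT2, integral_sub (integrable_const _) hV2, integral_div, integral_div,
      hV.integral_norm_sq, hT.integral_norm_sq, div_self hv.ne', div_self hs.ne',
      integral_const, probReal_univ, one_smul, sub_add_cancel, add_div, div_self hv.ne', add_comm]
  · exact hdiff.add hT2

end IsScalarCSCG

end ComplexGaussian

section VectorChannel

variable {Ω ι : Type*} [MeasurableSpace Ω] [Fintype ι] {P : Measure Ω}

lemma mutualInfo_smul_add_of_indepFun [IsProbabilityMeasure P] {b : Ω → ℂ} {Z : Ω → ι → ℂ}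
    (hb : AEMeasurable b P) (hZ : AEMeasurable Z P) (hbZ : IndepFun b Z P) {a c : ι → ℂ}
    (hca : c ⬝ᵥ a = 1)
    (hc : IndepFun (fun ω => c ⬝ᵥ Z ω) (fun ω => Z ω - (c ⬝ᵥ Z ω) • a) P) :
    mutualInfo (fun ω => b ω • a + Z ω) b P = mutualInfo (fun ω => b ω + c ⬝ᵥ Z ω) b P := by
  let V : Ω → ℂ := fun ω => c ⬝ᵥ Z ω
  let W : Ω → ι → ℂ := fun ω => Z ω - V ω • a
  let f : (ι → ℂ) → ℂ × (ι → ℂ) := fun y => (c ⬝ᵥ y, y - (c ⬝ᵥ y) • a)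
  let g : ℂ × (ι → ℂ) → ι → ℂ := fun z => z.1 • a + z.2
  have hf : Measurable f := by
    unfold f dotProduct
    fun_prop
  have hg : Measurable g := by fun_prop
  have hgf : Function.LeftInverse g f := fun y => add_sub_cancel _ _
  have hV : AEMeasurable V P := (measurable_fst.comp hf).comp_aemeasurable hZ
  have hW : AEMeasurable W P := (measurable_snd.comp hf).comp_aemeasurable hZ
  have hbVW : IndepFun (fun ω => (b ω + V ω, b ω)) W P :=
    (indepFun_prodMk_left hb hV hW (hbZ.comp measurable_id hf) hc).comp
      (φ := fun z : ℂ × ℂ => (z.1 + z.2, z.1)) (by fun_prop) measurable_id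
  have hfY : ∀ ω, f (b ω • a + Z ω) = (b ω + V ω, W ω) := fun ω => by
    simp only [f, V, W, dotProduct_add, dotProduct_smul, hca, smul_eq_mul, mul_one, add_smul,
      add_sub_add_left_eq_sub]
  rw [← mutualInfo_comp_of_leftInverse (by fun_prop) hb hf hg hgf]
  simp only [hfY]
  exact mutualInfo_prodMk_of_indepFun (hb.add hV) hb hW hbVW

variable [DecidableEq ι] {R : Matrix ι ι ℂ} {a : ι → ℂ}

/-- The row vector `c = aᴴ R⁻¹ / (aᴴ R⁻¹ a)` of the whitened matched filter `y ↦ c y` for the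
direction `a` in noise of covariance `R`, normalized by `c a = 1`. -/
noncomputable def matchedFilter (R : Matrix ι ι ℂ) (a : ι → ℂ) : ι → ℂ :=
  (star a ⬝ᵥ R⁻¹ *ᵥ a)⁻¹ • (star a ᵥ* R⁻¹)

lemma matchedFilter_dotProduct (hR : R.PosDef) (ha : a ≠ 0) : matchedFilter R a ⬝ᵥ a = 1 := by
  rw [matchedFilter, smul_dotProduct, ← Matrix.dotProduct_mulVec, smul_eq_mul,
    inv_mul_cancel₀ (hR.inv.dotProduct_mulVec_pos ha).ne']

lemma matchedFilter_vecMul (hR : R.PosDef) (a : ι → ℂ) :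
    matchedFilter R a ᵥ* R = (star a ⬝ᵥ R⁻¹ *ᵥ a)⁻¹ • star a := by
  rw [matchedFilter, Matrix.smul_vecMul, Matrix.vecMul_vecMul,
    Matrix.nonsing_inv_mul _ ((Matrix.isUnit_iff_isUnit_det R).1 hR.isUnit), Matrix.vecMul_one]

lemma matchedFilter_dotProduct_mulVec_star (hR : R.PosDef) (ha : a ≠ 0) :
    matchedFilter R a ⬝ᵥ R *ᵥ star (matchedFilter R a) = (star a ⬝ᵥ R⁻¹ *ᵥ a)⁻¹ := by
  rw [Matrix.dotProduct_mulVec, matchedFilter_vecMul hR, smul_dotProduct,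
    Matrix.star_dotProduct_star, matchedFilter_dotProduct hR ha, star_one, smul_eq_mul, mul_one]

namespace IsCSCG

variable {Z : Ω → ι → ℂ}

lemma matchedFilter_dotProduct (hZ : IsCSCG Z R P) (hR : R.PosDef) (ha : a ≠ 0) :
    IsScalarCSCG (fun ω => matchedFilter R a ⬝ᵥ Z ω) (star a ⬝ᵥ R⁻¹ *ᵥ a).re⁻¹ P := by
  refine hZ.dotProduct ?_
  rw [matchedFilter_dotProduct_mulVec_star hR ha, Complex.ofReal_inv,
    ← Complex.eq_re_of_ofReal_le (hR.inv.dotProduct_mulVec_pos ha).le]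

lemma indepFun_matchedFilter (hZ : IsCSCG Z R P) (hR : R.PosDef) (ha : a ≠ 0) :
    IndepFun (fun ω => matchedFilter R a ⬝ᵥ Z ω)
      (fun ω => Z ω - (matchedFilter R a ⬝ᵥ Z ω) • a) P := by
  set c := matchedFilter R a
  let B : Matrix ι ι ℂ := 1 - Matrix.vecMulVec a c
  have hB : ∀ z, B *ᵥ z = z - (c ⬝ᵥ z) • a := fun z => by
    rw [Matrix.sub_mulVec, Matrix.one_mulVec, Matrix.vecMulVec_mulVec, op_smul_eq_smul]
  have hBa : B *ᵥ a = 0 := by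
    rw [hB, UplinkISAC.matchedFilter_dotProduct hR ha, one_smul, sub_self]
  have hcB : Matrix.replicateRow (Fin 1) c * R * Bᴴ = 0 := by
    ext _ j
    have h : (c ᵥ* R) ᵥ* Bᴴ = 0 := by
      rw [matchedFilter_vecMul hR, Matrix.smul_vecMul, ← Matrix.star_mulVec, hBa, star_zero,
        smul_zero]
    exact congrFun h j
  have hind := hZ.indepFun_mulVec hcB
  simp only [hB] at hind
  exact hind.comp (measurable_pi_apply 0) measurable_id

end IsCSCG

lemma mutualInfo_smul_add {b : Ω → ℂ} {α : ℝ} (hb : IsScalarCSCG b α P) {Z : Ω → ι → ℂ}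
    (hZ : IsCSCG Z R P) (hR : R.PosDef) (hbZ : IndepFun b Z P) (a : ι → ℂ) :
    mutualInfo (fun ω => b ω • a + Z ω) b P =
      ENNReal.ofReal (Real.log (1 + α * (star a ⬝ᵥ R⁻¹ *ᵥ a).re)) := by
  have := hb.gaussianLaw.isProbabilityMeasure
  have mb := hb.gaussianLaw.aemeasurable
  have mZ := hZ.hasGaussianLaw.aemeasurable
  rcases eq_or_ne a 0 with rfl | ha
  · simp only [smul_zero, zero_add, star_zero, zero_dotProduct, Complex.zero_re, mul_zero,
      add_zero, Real.log_one, ENNReal.ofReal_zero]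
    exact mutualInfo_of_indepFun mZ mb hbZ.symm
  have hV := hZ.matchedFilter_dotProduct hR ha
  have hbV : IndepFun b (fun ω => matchedFilter R a ⬝ᵥ Z ω) P :=
    hbZ.comp (φ := id) (ψ := fun z => matchedFilter R a ⬝ᵥ z) measurable_id
      (by unfold dotProduct; fun_prop)
  have hq : 0 < (star a ⬝ᵥ R⁻¹ *ᵥ a).re :=
    (Complex.pos_iff.1 (hR.inv.dotProduct_mulVec_pos ha)).1
  rw [mutualInfo_smul_add_of_indepFun mb mZ hbZ (matchedFilter_dotProduct hR ha)
    (hZ.indepFun_matchedFilter hR ha), hb.mutualInfo_add hV hbV (inv_pos.2 hq), div_inv_eq_mul]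

end VectorChannel

section Uplink

section Matrix

lemma star_vec_vecMulVec_dotProduct_kronecker_mulVec {ι κ : Type*} [Fintype ι] [Fintype κ]
    (A : Matrix ι ι ℂ) (B : Matrix κ κ ℂ) (u : ι → ℂ) (v : κ → ℂ) :
    star (Matrix.vecMulVec u v).vec ⬝ᵥ (B ⊗ₖ A) *ᵥ (Matrix.vecMulVec u v).vec =
      (star u ⬝ᵥ A *ᵥ u) * (star v ⬝ᵥ B *ᵥ v) := by
  have h : A * Matrix.vecMulVec u v * Bᵀ = Matrix.vecMulVec (A *ᵥ u) (B *ᵥ v) := by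
    rw [Matrix.mul_vecMulVec, Matrix.vecMulVec_mul, Matrix.vecMul_transpose]
  rw [Matrix.kronecker_mulVec_vec, h, Matrix.star_vec_dotProduct_vec,
    Matrix.conjTranspose_vecMulVec, Matrix.vecMulVec_mul_vecMulVec, Matrix.trace_vecMulVec,
    dotProduct_smul, smul_eq_mul]

variable {ι : Type*} [DecidableEq ι]

/-- The covariance `I + p c cᴴ` across the antennas of a signal of power `p` received through the
channel `c` in unit white noise. -/
noncomputable def spatialCovariance (p : ℝ) (c : ι → ℂ) : Matrix ι ι ℂ :=
  1 + (p : ℂ) • Matrix.vecMulVec c (star c)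

lemma posDef_spatialCovariance [Finite ι] {p : ℝ} (hp : 0 ≤ p) (c : ι → ℂ) :
    (spatialCovariance p c).PosDef :=
  Matrix.PosDef.one.add_posSemidef
    ((Matrix.posSemidef_vecMulVec_self_star c).smul (Complex.zero_le_real.2 hp))

variable [Fintype ι]

lemma spatialCovariance_mulVec (p : ℝ) (c x : ι → ℂ) :
    spatialCovariance p c *ᵥ x = x + (p * (star c ⬝ᵥ x)) • c := by
  rw [spatialCovariance, Matrix.add_mulVec, Matrix.one_mulVec, Matrix.smul_mulVec,
    Matrix.vecMulVec_mulVec, op_smul_eq_smul, smul_smul]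

lemma inv_spatialCovariance_mulVec {p : ℝ} (hp : 0 ≤ p) (c x : ι → ℂ) :
    (spatialCovariance p c)⁻¹ *ᵥ x =
      x - (p * (star c ⬝ᵥ x) / (1 + p * (star c ⬝ᵥ c))) • c := by
  have hD : 1 + (p : ℂ) * (star c ⬝ᵥ c) ≠ 0 :=
    (add_pos_of_pos_of_nonneg one_pos
      (mul_nonneg (Complex.zero_le_real.2 hp) (dotProduct_star_self_nonneg c))).ne'
  have hdet := (Matrix.isUnit_iff_isUnit_det _).1 (posDef_spatialCovariance hp c).isUnit
  have h : spatialCovariance p c *ᵥ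
      (x - (p * (star c ⬝ᵥ x) / (1 + p * (star c ⬝ᵥ c))) • c) = x := by
    rw [spatialCovariance_mulVec, dotProduct_sub, dotProduct_smul, smul_eq_mul, sub_add, ← sub_smul,
      sub_eq_self]
    convert zero_smul ℂ c
    field_simp
    ring
  conv_lhs => rw [← h]
  rw [Matrix.mulVec_mulVec, Matrix.nonsing_inv_mul _ hdet, Matrix.one_mulVec]

end Matrix

variable {Ω : Type*} [MeasurableSpace Ω] {P : Measure Ω} {N L : ℕ}

lemma star_ofLp_dotProduct (x y : EuclideanSpace ℂ (Fin N)) :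
    star x.ofLp ⬝ᵥ y.ofLp = inner ℂ x y := by
  rw [EuclideanSpace.inner_eq_star_dotProduct, dotProduct_comm]

lemma star_ofLp_dotProduct_self (x : EuclideanSpace ℂ (Fin N)) :
    star x.ofLp ⬝ᵥ x.ofLp = (‖x‖ : ℂ) ^ 2 :=
  (star_ofLp_dotProduct x x).trans (inner_self_eq_norm_sq_to_K x)

/-- The gain `hᴴ (I + p c cᴴ)⁻¹ h` of the channel `h` after whitening against
`spatialCovariance p c`, in closed form. -/
noncomputable def whitenedGain (p : ℝ) (c h : EuclideanSpace ℂ (Fin N)) : ℝ :=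
  ‖h‖ ^ 2 - p * ‖inner ℂ h c‖ ^ 2 / (1 + p * ‖c‖ ^ 2)

lemma star_ofLp_dotProduct_inv_spatialCovariance_mulVec {p : ℝ} (hp : 0 ≤ p)
    (c h : EuclideanSpace ℂ (Fin N)) :
    star h.ofLp ⬝ᵥ (spatialCovariance p c.ofLp)⁻¹ *ᵥ h.ofLp = whitenedGain p c h := by
  have hcross : inner ℂ c h * inner ℂ h c = ((‖inner ℂ h c‖ : ℂ)) ^ 2 := by
    rw [← inner_conj_symm c h, Complex.conj_mul']
  rw [inv_spatialCovariance_mulVec hp, dotProduct_sub, dotProduct_smul, smul_eq_mul,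
    star_ofLp_dotProduct_self, star_ofLp_dotProduct_self, star_ofLp_dotProduct,
    star_ofLp_dotProduct, whitenedGain]
  push_cast
  rw [← hcross]
  ring

lemma whitenedGain_nonneg {p : ℝ} (hp : 0 ≤ p) (c h : EuclideanSpace ℂ (Fin N)) :
    0 ≤ whitenedGain p c h := by
  rw [← Complex.zero_le_real, ← star_ofLp_dotProduct_inv_spatialCovariance_mulVec hp]
  exact (posDef_spatialCovariance hp c.ofLp).inv.posSemidef.dotProduct_mulVec_nonneg h.ofLp

lemma secondMoment_interferencePlusNoise {p : ℝ} (hp : 0 ≤ p) (c : EuclideanSpace ℂ (Fin N))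
    {s : Ω → Fin L → ℂ} (hs_meas : AEMeasurable s P) (hs : secondMoment s P = 1)
    {V : Ω → Matrix (Fin N) (Fin L) ℂ} (hV_meas : AEMeasurable (fun ω => (V ω).vec) P)
    (hV_mean : ∀ k, ∫ ω, (V ω).vec k ∂P = 0) (hV : secondMoment (fun ω => (V ω).vec) P = 1)
    (hsV : IndepFun s (fun ω => (V ω).vec) P) :
    secondMoment (fun ω => (interferencePlusNoise p c (s ω) (V ω)).vec) P =
      (1 : Matrix (Fin L) (Fin L) ℂ) ⊗ₖ spatialCovariance p c.ofLp := by
  let u : Fin N → ℂ := (Real.sqrt p : ℂ) • c.ofLp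
  let S : (Fin L → ℂ) → Fin L × Fin N → ℂ := fun x => (Matrix.vecMulVec u (star x)).vec
  have hS : Measurable S :=
    (by unfold S Matrix.vec Matrix.vecMulVec; fun_prop : Continuous S).measurable
  have huu : Matrix.vecMulVec u (star u) = (p : ℂ) • Matrix.vecMulVec c.ofLp (star c.ofLp) := by
    simp only [u, star_smul, Matrix.smul_vecMulVec, Matrix.vecMulVec_smul, smul_smul,
      Complex.star_def, Complex.conj_ofReal, ← Complex.ofReal_mul, Real.mul_self_sqrt hp]
  have hsum : (fun ω => (interferencePlusNoise p c (s ω) (V ω)).vec) =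
      (fun ω => S (s ω)) + fun ω => (V ω).vec := by
    ext ω
    simp only [interferencePlusNoise, S, u, Matrix.smul_vecMulVec, Matrix.vec_add, Pi.add_apply]
  have hs2 : MemLp s 2 P := memLp_two_of_secondMoment_apply_ne_zero hs_meas.aestronglyMeasurable
    fun i => by rw [hs, Matrix.one_apply_eq]; exact one_ne_zero
  have hV2 : MemLp (fun ω => (V ω).vec) 2 P :=
    memLp_two_of_secondMoment_apply_ne_zero hV_meas.aestronglyMeasurable
      fun k => by rw [hV, Matrix.one_apply_eq]; exact one_ne_zero
  have hS2 : MemLp (fun ω => S (s ω)) 2 P :=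
    MemLp.of_eval fun k => (hs2.star.eval k.1).const_mul (u k.2)
  rw [hsum, secondMoment_add_of_indepFun hS2 hV2 (hsV.comp hS measurable_id) hV_mean,
    secondMoment_vec_vecMulVec_star, hs, hV, huu, Matrix.transpose_one, spatialCovariance,
    Matrix.kronecker_add, Matrix.one_kronecker_one, add_comm]

lemma vec_echo (ps : ℝ) (hs w : EuclideanSpace ℂ (Fin N)) (ss : EuclideanSpace ℂ (Fin L)) (b : ℂ) :
    (echo ps hs w ss b).vec =
      b • ((Real.sqrt ps : ℂ) * (hs.ofLp ⬝ᵥ w.ofLp)) •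
        (Matrix.vecMulVec hs.ofLp (star ss.ofLp)).vec := by
  simp only [echo, targetResponse, Matrix.smul_mulVec, Matrix.vecMulVec_mulVec, op_smul_eq_smul,
    Matrix.smul_vecMulVec, Matrix.vec_smul, smul_smul]
  congr 1
  ring

lemma mutualInfo_echo_add {ps : ℝ} (hps : 0 ≤ ps) (hs w : EuclideanSpace ℂ (Fin N))
    (ss : EuclideanSpace ℂ (Fin L)) {β : Ω → ℂ} {α : ℝ} (hβ : IsScalarCSCG β α P)
    {C : Matrix (Fin N) (Fin N) ℂ} (hC : C.PosDef) {Z : Ω → Matrix (Fin N) (Fin L) ℂ}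
    (hZ : IsCSCG (fun ω => (Z ω).vec) ((1 : Matrix (Fin L) (Fin L) ℂ) ⊗ₖ C) P)
    (hβZ : IndepFun β (fun ω => (Z ω).vec) P) :
    mutualInfo (fun ω => (echo ps hs w ss (β ω) + Z ω).vec) β P =
      ENNReal.ofReal (Real.log (1 + ps * ‖ss‖ ^ 2 * α * ‖hs.ofLp ⬝ᵥ w.ofLp‖ ^ 2 *
        (star hs.ofLp ⬝ᵥ C⁻¹ *ᵥ hs.ofLp).re)) := by
  set d : ℂ := (Real.sqrt ps : ℂ) * (hs.ofLp ⬝ᵥ w.ofLp) with hd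
  have hdd : star d * d = ((ps * ‖hs.ofLp ⬝ᵥ w.ofLp‖ ^ 2 : ℝ) : ℂ) := by
    rw [Complex.star_def, Complex.conj_mul', hd, norm_mul, Complex.norm_real, Real.norm_eq_abs,
      ← Complex.ofReal_pow, mul_pow, sq_abs, Real.sq_sqrt hps]
  have hss : star (star ss.ofLp) ⬝ᵥ star ss.ofLp = ((‖ss‖ ^ 2 : ℝ) : ℂ) := by
    rw [star_star, dotProduct_comm, star_ofLp_dotProduct_self, Complex.ofReal_pow]
  simp only [Matrix.vec_add, vec_echo]
  rw [mutualInfo_smul_add hβ hZ (Matrix.PosDef.one.kronecker hC) hβZ, Matrix.inv_kronecker,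
    inv_one, ← hd, star_smul, smul_dotProduct, Matrix.mulVec_smul, dotProduct_smul,
    star_vec_vecMulVec_dotProduct_kronecker_mulVec, Matrix.one_mulVec, hss, smul_smul,
    smul_eq_mul, hdd, Complex.re_ofReal_mul, mul_comm (_ ⬝ᵥ _), Complex.re_ofReal_mul]
  ring_nf

lemma sensingRate_eq (hL : L ≠ 0) {pc ps : ℝ} (hpc : 0 ≤ pc) (hps : 0 ≤ ps)
    (hc hs w : EuclideanSpace ℂ (Fin N)) (ss : EuclideanSpace ℂ (Fin L)) {β : Ω → ℂ} {α : ℝ}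
    (hβ : IsScalarCSCG β α P) {Z : Ω → Matrix (Fin N) (Fin L) ℂ}
    (hZ : IsCSCG (fun ω => (Z ω).vec)
      ((1 : Matrix (Fin L) (Fin L) ℂ) ⊗ₖ spatialCovariance pc hc.ofLp) P)
    (hβZ : IndepFun β (fun ω => (Z ω).vec) P) :
    sensingRate ps hs w ss β Z P =
      ENNReal.ofReal (1 / L * Real.logb 2 (1 + ps * ‖ss‖ ^ 2 * α * ‖hs.ofLp ⬝ᵥ w.ofLp‖ ^ 2 *
        whitenedGain pc hc hs)) := by
  rw [sensingRate, mutualInfoBits,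
    mutualInfo_echo_add hps hs w ss hβ (posDef_spatialCovariance hpc hc.ofLp) hZ hβZ,
    star_ofLp_dotProduct_inv_spatialCovariance_mulVec hpc, Complex.ofReal_re,
    ← ENNReal.ofReal_div_of_pos (Real.log_pos one_lt_two), ← ENNReal.ofReal_natCast L,
    ← ENNReal.ofReal_div_of_pos (Nat.cast_pos.2 hL.pos), Real.log_div_log, one_div_mul_eq_div]

lemma norm_ofLp_dotProduct_le (x y : EuclideanSpace ℂ (Fin N)) :
    ‖x.ofLp ⬝ᵥ y.ofLp‖ ≤ ‖x‖ * ‖y‖ := by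
  have h := norm_inner_le_norm (𝕜 := ℂ) (WithLp.toLp 2 (star x.ofLp)) y
  rw [EuclideanSpace.inner_eq_star_dotProduct, star_star, dotProduct_comm] at h
  simpa only [EuclideanSpace.norm_eq, Pi.star_apply, norm_star] using h

lemma dotProduct_sensingBeamformer {hs : EuclideanSpace ℂ (Fin N)} (hhs : hs ≠ 0) :
    hs.ofLp ⬝ᵥ (sensingBeamformer hs).ofLp = ‖hs‖ := by
  rw [sensingBeamformer, WithLp.ofLp_smul, dotProduct_smul, dotProduct_comm,
    star_ofLp_dotProduct_self, smul_eq_mul, Complex.ofReal_inv, sq,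
    inv_mul_cancel_left₀ (Complex.ofReal_ne_zero.2 (norm_ne_zero_iff.2 hhs))]

lemma norm_dotProduct_sensingBeamformer {hs : EuclideanSpace ℂ (Fin N)} (hhs : hs ≠ 0) :
    ‖hs.ofLp ⬝ᵥ (sensingBeamformer hs).ofLp‖ = ‖hs‖ := by
  rw [dotProduct_sensingBeamformer hhs, Complex.norm_real, norm_norm]

end Uplink

end UplinkISAC

theorem theorem7_general {N L : ℕ} (pc ps αs : ℝ) (hpc : 0 ≤ pc) (hps : 0 ≤ ps)
    (hc hs : EuclideanSpace ℂ (Fin N)) (hhs : hs ≠ 0)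
    (ss : EuclideanSpace ℂ (Fin L)) (hss : (L : ℝ)⁻¹ * ‖ss‖ ^ 2 = 1)
    {Ω : Type*} [MeasurableSpace Ω] (P : Measure Ω)
    (sc : Ω → Fin L → ℂ) (hsc_meas : AEMeasurable sc P)
    (hsc : UplinkISAC.secondMoment sc P = 1)
    (Nu : Ω → Matrix (Fin N) (Fin L) ℂ) (hNu_meas : AEMeasurable (fun ω => (Nu ω).vec) P)
    (hNu_mean : ∀ k, ∫ ω, (Nu ω).vec k ∂P = 0)
    (hNu_cov : UplinkISAC.secondMoment (fun ω => (Nu ω).vec) P = 1)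
    (hscNu : IndepFun sc (fun ω => (Nu ω).vec) P)
    {Ω' : Type*} [MeasurableSpace Ω'] (Q : Measure Ω')
    (β : Ω' → ℂ) (hβ : UplinkISAC.IsScalarCSCG β αs Q)
    (Z : Ω' → Matrix (Fin N) (Fin L) ℂ)
    (hZ : UplinkISAC.IsCSCG (fun ω => (Z ω).vec)
      (UplinkISAC.secondMoment
        (fun ω => (UplinkISAC.interferencePlusNoise pc hc (sc ω) (Nu ω)).vec) P) Q)
    (hβZ : IndepFun β (fun ω => (Z ω).vec) Q) :
    UplinkISAC.sensingRate ps hs (UplinkISAC.sensingBeamformer hs) ss β Z Q ≠ ∞ ∧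
    (UplinkISAC.sensingRate ps hs (UplinkISAC.sensingBeamformer hs) ss β Z Q).toReal =
      1 / (L : ℝ) * Real.logb 2 (1 + ps * L * αs * ‖hs‖ ^ 2 *
        (‖hs‖ ^ 2 - pc * ‖inner ℂ hs hc‖ ^ 2 / (1 + pc * ‖hc‖ ^ 2))) ∧
    ∀ w : EuclideanSpace ℂ (Fin N), ‖w‖ = 1 →
      UplinkISAC.sensingRate ps hs w ss β Z Q ≤
        UplinkISAC.sensingRate ps hs (UplinkISAC.sensingBeamformer hs) ss β Z Q := by
  have hL : L ≠ 0 := by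
    rintro rfl
    simp at hss
  have hss' : ‖ss‖ ^ 2 = L := ((inv_mul_eq_one₀ (Nat.cast_ne_zero.2 hL)).1 hss).symm
  rw [UplinkISAC.secondMoment_interferencePlusNoise hpc hc hsc_meas hsc hNu_meas hNu_mean
    hNu_cov hscNu] at hZ
  have hrate := fun w => UplinkISAC.sensingRate_eq hL hpc hps hc hs w ss hβ hZ hβZ
  have hgain := UplinkISAC.whitenedGain_nonneg hpc hc hs
  have hα := hβ.nonneg
  rw [hss'] at hrate
  have hbeam := UplinkISAC.norm_dotProduct_sensingBeamformer hhs
  refine ⟨hrate _ ▸ ENNReal.ofReal_ne_top, ?_, fun w hw => ?_⟩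
  · rw [hrate, hbeam, ENNReal.toReal_ofReal, UplinkISAC.whitenedGain]
    exact mul_nonneg (by positivity) (Real.logb_nonneg one_lt_two
      (le_add_of_nonneg_right (by positivity)))
  · have hle : ‖hs.ofLp ⬝ᵥ w.ofLp‖ ≤ ‖hs‖ :=
      (UplinkISAC.norm_ofLp_dotProduct_le hs w).trans_eq (by rw [hw, mul_one])
    rw [hrate, hrate, hbeam]
    gcongr
    exact one_lt_two

/-- The physical communication signal `s_c` and noise `N_u` live on `(Ω, P)`. Treating
`Z_c = √p_c h_c s_cᴴ + N_u` as Gaussian noise means replacing it by a circularly symmetric complex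
Gaussian `Z`, independent of `β`, with the covariance matrix `E{vec(Z_c) vec(Z_c)ᴴ}`; the pair
`(β, Z)` lives on `(Ω', Q)`, which may be the same space. -/
theorem theorem7 {N L : ℕ} (hL : 0 < L)
    (pc ps αs : ℝ) (hpc : 0 ≤ pc) (hps : 0 ≤ ps) (hαs : 0 ≤ αs)
    (hc hs : EuclideanSpace ℂ (Fin N)) (hhs : hs ≠ 0)
    (ss : EuclideanSpace ℂ (Fin L)) (hss : (L : ℝ)⁻¹ * ‖ss‖ ^ 2 = 1)
    {Ω : Type*} [MeasurableSpace Ω] (P : Measure Ω) [IsProbabilityMeasure P]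
    (sc : Ω → Fin L → ℂ) (hsc_meas : AEMeasurable sc P)
    (hsc : UplinkISAC.secondMoment sc P = 1)
    (Nu : Ω → Matrix (Fin N) (Fin L) ℂ)
    (hNu : UplinkISAC.IsCSCG (fun ω => (Nu ω).vec) 1 P)
    (hscNu : IndepFun sc (fun ω => (Nu ω).vec) P)
    {Ω' : Type*} [MeasurableSpace Ω'] (Q : Measure Ω') [IsProbabilityMeasure Q]
    (β : Ω' → ℂ) (hβ : UplinkISAC.IsScalarCSCG β αs Q)
    (Z : Ω' → Matrix (Fin N) (Fin L) ℂ)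
    (hZ : UplinkISAC.IsCSCG (fun ω => (Z ω).vec)
      (UplinkISAC.secondMoment
        (fun ω => (UplinkISAC.interferencePlusNoise pc hc (sc ω) (Nu ω)).vec) P) Q)
    (hβZ : IndepFun β (fun ω => (Z ω).vec) Q) :
    UplinkISAC.sensingRate ps hs (UplinkISAC.sensingBeamformer hs) ss β Z Q ≠ ∞ ∧
    (UplinkISAC.sensingRate ps hs (UplinkISAC.sensingBeamformer hs) ss β Z Q).toReal =
      1 / (L : ℝ) * Real.logb 2 (1 + ps * L * αs * ‖hs‖ ^ 2 *
        (‖hs‖ ^ 2 - pc * ‖inner ℂ hs hc‖ ^ 2 / (1 + pc * ‖hc‖ ^ 2))) ∧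
    ∀ w : EuclideanSpace ℂ (Fin N), ‖w‖ = 1 →
      UplinkISAC.sensingRate ps hs w ss β Z Q ≤
        UplinkISAC.sensingRate ps hs (UplinkISAC.sensingBeamformer hs) ss β Z Q :=
  theorem7_general pc ps αs hpc hps hc hs hhs ss hss P sc hsc_meas hsc Nu
    hNu.hasGaussianLaw.aemeasurable hNu.mean_eq hNu.covariance_eq hscNu Q β hβ Z hZ hβZ
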